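/- Let $\beta\in\{2,4\}$ and, for each integer $N\ge 1$, let $g_N:(0,\infty)\to\mathbb{R}$ be differentiable and set $Q_N(z)=g_N(|z|)$ for $z\in\mathbb{C}\setminus\{0\}$. Assume that $g_N$ converges pointwise on $(0,\infty)$ to a function $g:(0,\infty)\to\mathbb{R}$ that is differentiable on $(0,1]$, and that: 1. $g_N(r)/\log r\to+\infty$ as $r\to\infty$, for every $N$; 2. $g_N\in C^2(0,1]$ for every $N$; 3. $r\mapsto r\,g_N'(r)$ is strictly increasing on $(0,\infty)$ for every $N$; 4. $\lim_{r\to 0^+} r\,g'(r)=0$ and $g'(1)=\beta$. Let $dA(z)=\frac1\pi\,d^2z$ and let $(z_1,\dots,z_N)\in\mathbb{C}^N$ be distributed according to $$ d\mathbf{P}_N^{(2)}=\frac{1}{Z_N^{(2)}}\prod_{j>k}|z_j-z_k|^2\prod_{j=1}^N e^{-NQ_N(z_j)}\,dA(z_j)\qquad(\beta=2), $$ $$ d\mathbf{P}_N^{(4)}=\frac{1}{Z_N^{(4)}}\prod_{j>k}|z_j-z_k|^2|z_j-\bar z_k|^2\prod_{j=1}^N|z_j-\bar z_j|^2\,e^{-NQ_N(z_j)}\,dA(z_j)\qquad(\beta=4),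 $$ where $Z_N^{(\beta)}$ is the normalising constant, assumed to be finite for every $N \ge 1$. For $a>0$ let $\mathcal{N}_a$ be the number of indices $j\in\{1,\dots,N\}$ with $|z_j|<a$. Then for every $a\in(0,1]$, $$ \frac{1}{N}\,\mathcal{N}_a\;\longrightarrow\;\frac{a\,g'(a)}{\beta}\qquad\text{in probability as }N\to\infty, $$ that is, for every $\varepsilon>0$, $\ \mathbf{P}_N^{(\beta)}\big(\,\big|\tfrac1N\mathcal{N}_a-\tfrac{a\,g'(a)}{\beta}\big|\ge\varepsilon\big)\to 0$ as $N\to\infty$. -/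

import Mathlib

open MeasureTheory Filter Topology

noncomputable section

/-- The two planar ensembles: complex matrix elements (`β = 2`) and quaternion matrix
elements (`β = 4`). -/
inductive PlanarEnsemble where
  | complex
  | symplectic

namespace PlanarEnsemble

/-- The label `β` of an ensemble. -/
def beta : PlanarEnsemble → ℝ
  | complex => 2
  | symplectic => 4

/-- The interaction factor of the joint density of the points `z 0, …, z (N - 1)`:
`∏_{j > k} |z_j - z_k|²` for `β = 2`, and
`∏_{j > k} |z_j - z_k|² |z_j - conj z_k|² · ∏_j |z_j - conj z_j|²` for `β = 4`. -/
def interaction {N : ℕ} : PlanarEnsemble → (Fin N → ℂ) → ℝ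
  | complex, z => ∏ j, ∏ k ∈ Finset.Iio j, ‖z j - z k‖ ^ 2
  | symplectic, z =>
      (∏ j, ∏ k ∈ Finset.Iio j, ‖z j - z k‖ ^ 2 * ‖z j - star (z k)‖ ^ 2) *
        ∏ j, ‖z j - star (z j)‖ ^ 2

end PlanarEnsemble

/-- The normalised area measure `dA = π⁻¹ d²z` on `ℂ`. -/
def areaMeasure : Measure ℂ := ENNReal.ofReal Real.pi⁻¹ • volume

/-- The radially symmetric external potential `Q(z) = g(|z|)`. -/
def radialPotential (g : ℝ → ℝ) (z : ℂ) : ℝ := g ‖z‖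

/-- The unnormalised joint density of `N` points in the potential `Q(z) = g(|z|)`. -/
def gibbsWeight (𝓔 : PlanarEnsemble) (g : ℝ → ℝ) (N : ℕ) (z : Fin N → ℂ) : ℝ :=
  𝓔.interaction z * ∏ j, Real.exp (-(N * radialPotential g (z j)))

/-- The partition function `Z_N^{(β)}`, with values in `[0, ∞]`. -/
def partitionFunction (𝓔 : PlanarEnsemble) (g : ℝ → ℝ) (N : ℕ) : ENNReal :=
  ∫⁻ z, ENNReal.ofReal (gibbsWeight 𝓔 g N z) ∂(Measure.pi fun _ : Fin N => areaMeasure)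

/-- The joint law `P_N^{(β)}` of the `N` points, a probability measure on `ℂ^N` as soon as
the partition function is finite. -/
def gibbsLaw (𝓔 : PlanarEnsemble) (g : ℝ → ℝ) (N : ℕ) : Measure (Fin N → ℂ) :=
  (partitionFunction 𝓔 g N)⁻¹ •
    (Measure.pi fun _ : Fin N => areaMeasure).withDensity
      (fun z => ENNReal.ofReal (gibbsWeight 𝓔 g N z))

/-- The number of points in the open disc of radius `a` centred at the origin. -/
def countDisc {N : ℕ} (a : ℝ) (z : Fin N → ℂ) : ℕ :=
  (Finset.univ.filter fun j => ‖z j‖ < a).card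

/-- The radially symmetric potentials `Q_N(z) = gN N |z|`, `N ≥ 1`, with pointwise limit
`Q(z) = g |z|` away from the origin, are suitable for the ensemble with label `β`. Only the
values of `gN N` and `g` on `(0, ∞)` matter. -/
structure SuitablePotential (β : ℝ) (gN : ℕ → ℝ → ℝ) (g : ℝ → ℝ) : Prop where
  /-- `g_N → g` pointwise on `(0, ∞)`. -/
  tendsto_limit : ∀ r, 0 < r → Tendsto (fun N => gN N r) atTop (𝓝 (g r))
  /-- `g_N(r) ≫ log r` as `r → ∞`. -/
  growth : ∀ N, 1 ≤ N → Tendsto (fun r => gN N r / Real.log r) atTop atTop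
  /-- `g_N ∈ C²(0, 1]`. -/
  contDiffOn : ∀ N, 1 ≤ N → ContDiffOn ℝ 2 (gN N) (Set.Ioc 0 1)
  /-- `g_N'` exists on `(0, ∞)`. -/
  differentiableOn : ∀ N, 1 ≤ N → DifferentiableOn ℝ (gN N) (Set.Ioi 0)
  /-- `r g_N'(r)` increases on `(0, ∞)`. -/
  strictMonoOn : ∀ N, 1 ≤ N → StrictMonoOn (fun r => r * deriv (gN N) r) (Set.Ioi 0)
  /-- `g'` exists on `(0, 1]`. -/
  limit_differentiableAt : ∀ r ∈ Set.Ioc (0 : ℝ) 1, DifferentiableAt ℝ g r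
  /-- `r g'(r) → 0` as `r → 0`. -/
  limit_origin : Tendsto (fun r => r * deriv g r) (𝓝[>] 0) (𝓝 0)
  /-- `g'(1) = β`. -/
  limit_edge : deriv g 1 = β

end

/-!
In a radial potential the moduli of the points behave as if they were independent. Expanding the
Vandermonde determinants in the interaction and integrating out the angles leaves only diagonal
moments: for every positive radial weight `F`,
`∫ interaction(z) ∏ F(z j) = C ∏_k ∫ |z| ^ (2 b_k) F(z) dA(z)`, with `2 b_k + 2 = β (k + 1)` and a
constant `C` that depends only on the ensemble and `N` (`exists_lintegral_interaction`). For `β = 4`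
a permutation contributes only if it splits `0, …, 2N - 1` into pairs of neighbours, and such a
splitting is unique (`prod_max_of_adjacent`). The value of `C` never matters. The identity is proved
for truncated weights and extended by monotone convergence, so that no moment has to be finite.

Doubling the weight on a rotation invariant set gives an exponential Markov bound for the number of
points in it: this number hardly exceeds the number of `k` for which the `k`-th radial density
`r ^ (2 b_k) exp (-N g_N(r)) r dr` does not give small relative mass to the set
(`gibbsLaw_count_ge_le`).

In the variable `s = log r` the `k`-th density is `exp (N (τ s - g_N(e ^ s)))` with
`τ = β (k + 1) / N`, and the exponent is concave. Comparing it with its translate by a small fixed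
`h` (`radialMoment_restrict_le`) shows that the mass of `{r ≥ a}` is exponentially small when `τ` is
below `a g'(a)`, and the mass of `{r < a}` when `τ` is above `a g'(a)`; concavity transports the
comparison from `r = a` to the whole set, and at `r = a` only the pointwise convergence `g_N → g` is
used (`SuitablePotential.exists_scale`). Hence about `N a g'(a) / β` points lie in the disc of
radius `a`, where `0 ≤ a g'(a) ≤ β` because `r g'(r)` increases from `0` to `β` on `(0, 1]`.
-/

/-! ### Moments of radial weights -/

instance : SigmaFinite areaMeasure :=
  inferInstanceAs (SigmaFinite (Real.toNNReal Real.pi⁻¹ • (volume : Measure ℂ)))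

theorem measurePreserving_mul_areaMeasure (u : Circle) :
    MeasurePreserving (fun z : ℂ => (u : ℂ) * z) areaMeasure areaMeasure := by
  have h : MeasurePreserving (rotation u) (volume : Measure ℂ) volume :=
    (rotation u).measurePreserving
  exact h.smul_measure (ENNReal.ofReal Real.pi⁻¹)

theorem exists_circle_pow_ne {a b : ℕ} (hab : a ≠ b) :
    ∃ u : Circle, (u : ℂ) ^ a * star (u : ℂ) ^ b ≠ 1 := by
  have hab' : ((a : ℂ) - b) ≠ 0 := sub_ne_zero.2 (Nat.cast_injective.ne hab)
  refine ⟨Circle.exp (Real.pi / (a - b)), ?_⟩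
  have h : ((Circle.exp (Real.pi / (a - b)) : ℂ)) ^ a *
      star (Circle.exp (Real.pi / (a - b)) : ℂ) ^ b = -1 := by
    rw [RCLike.star_def, ← Circle.coe_inv_eq_conj, ← Circle.exp_neg, Circle.coe_exp,
      Circle.coe_exp, ← Complex.exp_nat_mul, ← Complex.exp_nat_mul, ← Complex.exp_add,
      ← Complex.exp_pi_mul_I]
    congr 1
    push_cast
    field_simp
    ring
  rw [h]
  norm_num

/-- The mixed moments of a radial weight vanish off the diagonal. -/
theorem integral_monomial_eq_zero {F : ℂ → ℝ} (hrad : ∀ z w : ℂ, ‖z‖ = ‖w‖ → F z = F w)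
    {a b : ℕ} (hab : a ≠ b) :
    ∫ z, z ^ a * star z ^ b * (F z : ℂ) ∂areaMeasure = 0 := by
  obtain ⟨u, hu⟩ := exists_circle_pow_ne hab
  have h := (measurePreserving_mul_areaMeasure u).integral_comp
    ((Homeomorph.mulLeft₀ (u : ℂ) (by simp)).measurableEmbedding)
    (fun z => z ^ a * star z ^ b * (F z : ℂ))
  have h2 : ∀ z : ℂ, ((u : ℂ) * z) ^ a * star ((u : ℂ) * z) ^ b * (F ((u : ℂ) * z) : ℂ)
      = ((u : ℂ) ^ a * star (u : ℂ) ^ b) * (z ^ a * star z ^ b * (F z : ℂ)) := by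
    intro z
    rw [hrad (u * z) z (by rw [norm_mul, Circle.norm_coe, one_mul]), star_mul', mul_pow, mul_pow]
    ring
  simp only [h2, integral_const_mul] at h
  by_contra h0
  exact hu (mul_right_cancel₀ h0 (by rw [h, one_mul]))

theorem integral_monomial_diag (F : ℂ → ℝ) (a : ℕ) :
    ∫ z, z ^ a * star z ^ a * (F z : ℂ) ∂areaMeasure
      = ((∫ z, ‖z‖ ^ (2 * a) * F z ∂areaMeasure : ℝ) : ℂ) := by
  rw [← integral_complex_ofReal]
  congr 1
  ext z
  rw [← mul_pow, RCLike.star_def, Complex.mul_conj, Complex.normSq_eq_norm_sq]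
  push_cast
  ring

/-! ### Expansion of the interaction for `β = 2` -/

theorem interaction_complex_eq {N : ℕ} (z : Fin N → ℂ) :
    ((PlanarEnsemble.complex.interaction z : ℝ) : ℂ)
      = (Matrix.vandermonde z).det * star (Matrix.vandermonde z).det := by
  rw [Matrix.det_vandermonde, PlanarEnsemble.interaction, star_prod, ← Finset.prod_mul_distrib]
  simp only [star_prod, ← Finset.prod_mul_distrib]
  push_cast
  rw [Finset.prod_comm' (s := Finset.univ) (t := fun j : Fin N => Finset.Iio j)
    (t' := Finset.univ) (s' := fun i : Fin N => Finset.Ioi i) (by simp)]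
  refine Finset.prod_congr rfl fun i _ => Finset.prod_congr rfl fun j _ => ?_
  rw [RCLike.star_def, Complex.mul_conj, Complex.normSq_eq_norm_sq]
  push_cast
  rfl

theorem det_vandermonde_eq_sum {n : ℕ} (v : Fin n → ℂ) :
    (Matrix.vandermonde v).det
      = ∑ σ : Equiv.Perm (Fin n), ((Equiv.Perm.sign σ : ℤ) : ℂ) * ∏ i, v i ^ (σ i : ℕ) := by
  rw [← Matrix.det_transpose, Matrix.det_apply']
  rfl

/-- Andréief's identity for the ensemble `β = 2` and a radial weight. -/
theorem integral_interaction_complex {N : ℕ} {F : ℂ → ℝ}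
    (hrad : ∀ z w : ℂ, ‖z‖ = ‖w‖ → F z = F w)
    (hint : ∀ a b : ℕ, Integrable (fun z : ℂ => z ^ a * star z ^ b * (F z : ℂ)) areaMeasure) :
    Integrable (fun z : Fin N → ℂ =>
        ((PlanarEnsemble.complex.interaction z * ∏ j, F (z j) : ℝ) : ℂ))
        (Measure.pi fun _ => areaMeasure) ∧
    ∫ z : Fin N → ℂ, ((PlanarEnsemble.complex.interaction z * ∏ j, F (z j) : ℝ) : ℂ)
        ∂(Measure.pi fun _ => areaMeasure)
      = (∑ σ : Equiv.Perm (Fin N), ∑ τ : Equiv.Perm (Fin N), if σ = τ then 1 else 0) *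
        ∏ k : Fin N, ((∫ z, ‖z‖ ^ (2 * (k : ℕ)) * F z ∂areaMeasure : ℝ) : ℂ) := by
  have hexp : ∀ z : Fin N → ℂ,
      ((PlanarEnsemble.complex.interaction z * ∏ j, F (z j) : ℝ) : ℂ)
      = ∑ σ : Equiv.Perm (Fin N), ∑ τ : Equiv.Perm (Fin N),
          (((Equiv.Perm.sign σ : ℤ) : ℂ) * ((Equiv.Perm.sign τ : ℤ) : ℂ)) *
            ∏ i, (z i ^ (σ i : ℕ) * star (z i) ^ (τ i : ℕ) * (F (z i) : ℂ)) := by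
    intro z
    rw [Complex.ofReal_mul, interaction_complex_eq, det_vandermonde_eq_sum, star_sum,
      Finset.sum_mul_sum, Finset.sum_mul]
    refine Finset.sum_congr rfl fun σ _ => ?_
    rw [Finset.sum_mul]
    refine Finset.sum_congr rfl fun τ _ => ?_
    simp only [Finset.prod_mul_distrib, star_mul', star_prod, star_pow, Complex.ofReal_prod]
    have : star (((Equiv.Perm.sign τ : ℤ) : ℂ)) = ((Equiv.Perm.sign τ : ℤ) : ℂ) := by simp
    rw [this]
    ring
  have hI : ∀ σ τ : Equiv.Perm (Fin N), Integrable (fun z : Fin N → ℂ =>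
      ∏ i, (z i ^ (σ i : ℕ) * star (z i) ^ (τ i : ℕ) * (F (z i) : ℂ)))
      (Measure.pi fun _ => areaMeasure) := fun σ τ =>
    Integrable.fintype_prod (f := fun i (x : ℂ) => x ^ (σ i : ℕ) * star x ^ (τ i : ℕ) * (F x : ℂ))
      fun i => hint (σ i) (τ i)
  simp only [hexp]
  refine ⟨integrable_finsetSum _ fun σ _ => integrable_finsetSum _ fun τ _ => (hI σ τ).const_mul _,
    ?_⟩
  rw [integral_finsetSum _ fun σ _ => integrable_finsetSum _ fun τ _ => (hI σ τ).const_mul _,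
    Finset.sum_mul]
  refine Finset.sum_congr rfl fun σ _ => ?_
  rw [integral_finsetSum _ fun τ _ => (hI σ τ).const_mul _, Finset.sum_mul]
  refine Finset.sum_congr rfl fun τ _ => ?_
  rw [integral_const_mul, integral_fintype_prod_eq_prod
    (f := fun i (x : ℂ) => x ^ (σ i : ℕ) * star x ^ (τ i : ℕ) * (F x : ℂ))]
  split_ifs with h
  · subst h
    have hs : ((Equiv.Perm.sign σ : ℤ) : ℂ) * ((Equiv.Perm.sign σ : ℤ) : ℂ) = 1 := by
      rw [← Int.cast_mul, Int.units_coe_mul_self, Int.cast_one]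
    simp only [integral_monomial_diag, hs]
    congr 1
    exact Equiv.prod_comp σ
      fun k : Fin N => ((∫ z, ‖z‖ ^ (2 * (k : ℕ)) * F z ∂areaMeasure : ℝ) : ℂ)
  · obtain ⟨i, hi⟩ : ∃ i, σ i ≠ τ i := by
      by_contra! hc
      exact h (Equiv.ext hc)
    rw [zero_mul, Finset.prod_eq_zero (Finset.mem_univ i), mul_zero]
    exact integral_monomial_eq_zero hrad fun h => hi (Fin.ext h)

/-! ### Splittings into pairs of neighbours -/

/-- If `0, …, 2N - 1` is split into `N` pairs of neighbours `{x j, y j}`, then these are the pairs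
`{2m, 2m + 1}`. -/
theorem div_two_eq_of_adjacent {N : ℕ} {x y : Fin N → ℕ} (hx : Function.Injective x)
    (hy : Function.Injective y) (hxy : ∀ j k, x j ≠ y k)
    (hsurj : ∀ n < N * 2, ∃ j, x j = n ∨ y j = n)
    (hxb : ∀ j, x j < N * 2) (hyb : ∀ j, y j < N * 2)
    (hadj : ∀ j, x j + 1 = y j ∨ y j + 1 = x j) (j : Fin N) :
    x j / 2 = y j / 2 := by
  suffices h : ∀ n, ∀ j, x j = n ∨ y j = n → x j / 2 = y j / 2 from h _ j (Or.inl rfl)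
  intro n
  induction n using Nat.strong_induction_on with
  | _ n ih =>
    intro j hj
    by_contra hne
    have h1 := hxb j
    have h2 := hyb j
    have h3 := hadj j
    -- A bad pair is `{2m + 1, 2m + 2}`; the partner of `2m` would have to be `2m + 1` as well.
    obtain ⟨k, hk⟩ := hsurj (2 * (min (x j) (y j) / 2)) (by omega)
    have h4 := ih _ (by omega) k hk
    have h5 := hadj k
    have h6 : x k ≠ x j ∧ y k ≠ y j := by
      constructor
      · intro h
        have := hx h
        subst this
        omega
      · intro h
        have := hy h
        subst this
        omega
    have h7 := hxy j k
    have h8 := hxy k j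
    omega

/-- In the situation of `div_two_eq_of_adjacent`, a product over the pairs is a product over `m`. -/
theorem prod_max_of_adjacent {N : ℕ} {x y : Fin N → ℕ} (hx : Function.Injective x)
    (hy : Function.Injective y) (hxy : ∀ j k, x j ≠ y k)
    (hsurj : ∀ n < N * 2, ∃ j, x j = n ∨ y j = n)
    (hxb : ∀ j, x j < N * 2) (hyb : ∀ j, y j < N * 2)
    (hadj : ∀ j, x j + 1 = y j ∨ y j + 1 = x j) (M : ℕ → ℂ) :
    ∏ j, M (max (x j) (y j)) = ∏ m : Fin N, M (2 * (m : ℕ) + 1) := by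
  have hdiv := div_two_eq_of_adjacent hx hy hxy hsurj hxb hyb hadj
  have hlt : ∀ j, x j / 2 < N := fun j => by have := hxb j; omega
  have hinj : Function.Injective fun j : Fin N => (⟨x j / 2, hlt j⟩ : Fin N) := by
    intro j k hjk
    have h0 : x j / 2 = x k / 2 := by simpa using hjk
    by_contra hne
    have h1 := hdiv j
    have h2 := hdiv k
    have h3 := hadj j
    have h4 := hadj k
    have h5 := hx.ne hne
    have h6 := hxy j k
    omega
  rw [← (Finite.injective_iff_bijective.1 hinj).prod_comp fun m : Fin N => M (2 * (m : ℕ) + 1)]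
  refine Finset.prod_congr rfl fun j _ => congrArg M ?_
  have h1 := hdiv j
  have h3 := hadj j
  simp only
  omega

/-! ### Expansion of the interaction for `β = 4` -/

/-- The symplectic interaction is a Vandermonde determinant in the `2N` variables
`z 0, z̄ 0, z 1, z̄ 1, …`, times `∏ (z j - z̄ j)`. -/
theorem interaction_symplectic_eq {N : ℕ} (z : Fin N → ℂ) :
    ((PlanarEnsemble.symplectic.interaction z : ℝ) : ℂ)
      = (∏ j, (z j - star (z j))) *
        (Matrix.vandermonde fun i : Fin (N * 2) =>
          if (finProdFinEquiv.symm i).2 = 0 then z (finProdFinEquiv.symm i).1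
            else star (z (finProdFinEquiv.symm i).1)).det := by
  have hns : ∀ w : ℂ, ((‖w‖ ^ 2 : ℝ) : ℂ) = w * star w := by
    intro w
    rw [RCLike.star_def, Complex.mul_conj, Complex.normSq_eq_norm_sq]
  set v : Fin (N * 2) → ℂ := fun i =>
    if (finProdFinEquiv.symm i).2 = 0 then z (finProdFinEquiv.symm i).1
      else star (z (finProdFinEquiv.symm i).1) with hv
  have hv0 : ∀ j, v (finProdFinEquiv (j, 0)) = z j := fun j => by
    simp only [hv, Equiv.symm_apply_apply]
    simp
  have hv1 : ∀ j, v (finProdFinEquiv (j, 1)) = star (z j) := fun j => by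
    simp only [hv, Equiv.symm_apply_apply]
    simp
  have hlt : ∀ (j k : Fin N) (s t : Fin 2),
      finProdFinEquiv (j, s) < finProdFinEquiv (k, t) ↔ j < k ∨ (j = k ∧ s < t) := by
    intro j k s t
    simp only [Fin.lt_def, finProdFinEquiv_apply_val, Fin.ext_iff]
    omega
  have hdet : (Matrix.vandermonde v).det =
      ∏ j, ∏ k, if j < k then ((‖z k - z j‖ ^ 2 * ‖z k - star (z j)‖ ^ 2 : ℝ) : ℂ)
        else if j = k then star (z j) - z j else 1 := by
    rw [Matrix.det_vandermonde]
    have h1 : ∀ i : Fin (N * 2), ∏ l ∈ Finset.Ioi i, (v l - v i)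
        = ∏ l, if i < l then v l - v i else 1 := by
      intro i
      rw [← Finset.prod_filter]
      congr 1
      ext; simp
    simp only [h1]
    rw [← finProdFinEquiv.prod_comp, Fintype.prod_prod_type]
    refine Finset.prod_congr rfl fun j _ => ?_
    rw [Fin.prod_univ_two]
    simp only [← finProdFinEquiv.prod_comp (fun l => if _ < l then v l - _ else 1),
      Fintype.prod_prod_type, Fin.prod_univ_two, hlt, hv0, hv1]
    rw [← Finset.prod_mul_distrib]
    refine Finset.prod_congr rfl fun k _ => ?_
    rcases lt_trichotomy j k with h | h | h
    · simp only [h, true_or, if_true]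
      rw [Complex.ofReal_mul, hns, hns]
      simp only [star_sub, star_star]
      ring
    · subst h
      simp
    · simp [h.ne', h.not_gt]
  rw [hdet, PlanarEnsemble.interaction]
  have hsplit : ∀ j k : Fin N,
      (if j < k then ((‖z k - z j‖ ^ 2 * ‖z k - star (z j)‖ ^ 2 : ℝ) : ℂ)
        else if j = k then star (z j) - z j else 1)
      = (if j < k then ((‖z k - z j‖ ^ 2 * ‖z k - star (z j)‖ ^ 2 : ℝ) : ℂ) else 1) *
        (if j = k then star (z j) - z j else 1) := by
    intro j k
    by_cases h : j < k
    · simp [h, h.ne]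
    · simp [h]
  simp only [hsplit, Finset.prod_mul_distrib, Finset.prod_ite_eq, Finset.mem_univ, if_true]
  rw [Finset.prod_comm (f := fun j k : Fin N => if j < k then _ else _)]
  rw [mul_left_comm, Complex.ofReal_mul]
  congr 1
  · rw [← Finset.prod_mul_distrib, Complex.ofReal_prod]
    refine Finset.prod_congr rfl fun k _ => ?_
    rw [← Finset.prod_mul_distrib, Complex.ofReal_prod, ← Finset.prod_filter]
    congr 1
    ext; simp
  · rw [Complex.ofReal_prod, ← Finset.prod_mul_distrib]
    refine Finset.prod_congr rfl fun k _ => ?_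
    rw [hns, star_sub, star_star]

/-- The coefficient `±1` or `0` with which the moment of order `max a b` enters the integral of
`(z - z̄) z ^ a z̄ ^ b` against a radial weight. -/
def adjacencySign (a b : ℕ) : ℂ := if a + 1 = b then 1 else if b + 1 = a then -1 else 0

theorem integral_skew_monomial {F : ℂ → ℝ} (hrad : ∀ z w : ℂ, ‖z‖ = ‖w‖ → F z = F w)
    (hint : ∀ a b : ℕ, Integrable (fun z : ℂ => z ^ a * star z ^ b * (F z : ℂ)) areaMeasure)
    (a b : ℕ) :
    ∫ z, (z - star z) * (z ^ a * star z ^ b) * (F z : ℂ) ∂areaMeasure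
      = adjacencySign a b * ((∫ z, ‖z‖ ^ (2 * max a b) * F z ∂areaMeasure : ℝ) : ℂ) := by
  have h : ∀ z : ℂ, (z - star z) * (z ^ a * star z ^ b) * (F z : ℂ)
      = z ^ (a + 1) * star z ^ b * (F z : ℂ) - z ^ a * star z ^ (b + 1) * (F z : ℂ) := by
    intro z
    ring
  simp only [h]
  rw [integral_sub (hint _ _) (hint _ _), adjacencySign]
  split_ifs with h1 h2
  · subst h1
    rw [integral_monomial_diag, integral_monomial_eq_zero hrad (by omega),
      max_eq_right (by omega), sub_zero, one_mul]
  · subst h2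
    rw [integral_monomial_diag, integral_monomial_eq_zero hrad (by omega),
      max_eq_left (by omega), zero_sub, neg_one_mul]
  · rw [integral_monomial_eq_zero hrad h1, integral_monomial_eq_zero hrad (Ne.symm h2), sub_zero,
      zero_mul]

/-- De Bruijn's identity for the ensemble `β = 4` and a radial weight: only the odd moments
survive. -/
theorem integral_interaction_symplectic {N : ℕ} {F : ℂ → ℝ}
    (hrad : ∀ z w : ℂ, ‖z‖ = ‖w‖ → F z = F w)
    (hint : ∀ a b : ℕ, Integrable (fun z : ℂ => z ^ a * star z ^ b * (F z : ℂ)) areaMeasure) :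
    Integrable (fun z : Fin N → ℂ =>
        ((PlanarEnsemble.symplectic.interaction z * ∏ j, F (z j) : ℝ) : ℂ))
        (Measure.pi fun _ => areaMeasure) ∧
    ∫ z : Fin N → ℂ, ((PlanarEnsemble.symplectic.interaction z * ∏ j, F (z j) : ℝ) : ℂ)
        ∂(Measure.pi fun _ => areaMeasure)
      = (∑ σ : Equiv.Perm (Fin (N * 2)), ((Equiv.Perm.sign σ : ℤ) : ℂ) *
          ∏ j : Fin N, adjacencySign (σ (finProdFinEquiv (j, 0))) (σ (finProdFinEquiv (j, 1)))) *
        ∏ k : Fin N, ((∫ z, ‖z‖ ^ (2 * (2 * (k : ℕ) + 1)) * F z ∂areaMeasure : ℝ) : ℂ) := by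
  have hexp : ∀ z : Fin N → ℂ,
      ((PlanarEnsemble.symplectic.interaction z * ∏ j, F (z j) : ℝ) : ℂ)
      = ∑ σ : Equiv.Perm (Fin (N * 2)), ((Equiv.Perm.sign σ : ℤ) : ℂ) *
          ∏ j : Fin N, ((z j - star (z j)) * (z j ^ (σ (finProdFinEquiv (j, 0)) : ℕ) *
            star (z j) ^ (σ (finProdFinEquiv (j, 1)) : ℕ)) * (F (z j) : ℂ)) := by
    intro z
    rw [Complex.ofReal_mul, interaction_symplectic_eq, det_vandermonde_eq_sum,
      Finset.mul_sum, Finset.sum_mul]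
    refine Finset.sum_congr rfl fun σ _ => ?_
    rw [← finProdFinEquiv.prod_comp, Fintype.prod_prod_type]
    simp only [Fin.prod_univ_two, Equiv.symm_apply_apply, if_true, one_ne_zero, if_false,
      Finset.prod_mul_distrib, Complex.ofReal_prod]
    ring
  have hI : ∀ σ : Equiv.Perm (Fin (N * 2)), Integrable (fun z : Fin N → ℂ =>
      ∏ j : Fin N, ((z j - star (z j)) * (z j ^ (σ (finProdFinEquiv (j, 0)) : ℕ) *
            star (z j) ^ (σ (finProdFinEquiv (j, 1)) : ℕ)) * (F (z j) : ℂ)))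
      (Measure.pi fun _ => areaMeasure) := fun σ =>
    Integrable.fintype_prod (f := fun j (x : ℂ) =>
      (x - star x) * (x ^ (σ (finProdFinEquiv (j, 0)) : ℕ) *
            star x ^ (σ (finProdFinEquiv (j, 1)) : ℕ)) * (F x : ℂ))
      fun j => by
        refine ((hint (σ (finProdFinEquiv (j, 0)) + 1) (σ (finProdFinEquiv (j, 1)))).sub
          (hint (σ (finProdFinEquiv (j, 0))) (σ (finProdFinEquiv (j, 1)) + 1))).congr
          (Eventually.of_forall fun x => ?_)
        simp only [Pi.sub_apply]
        ring
  simp only [hexp]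
  refine ⟨integrable_finsetSum _ fun σ _ => (hI σ).const_mul _, ?_⟩
  rw [integral_finsetSum _ fun σ _ => (hI σ).const_mul _, Finset.sum_mul]
  refine Finset.sum_congr rfl fun σ _ => ?_
  rw [integral_const_mul, integral_fintype_prod_eq_prod
    (f := fun j (x : ℂ) => (x - star x) * (x ^ (σ (finProdFinEquiv (j, 0)) : ℕ) *
            star x ^ (σ (finProdFinEquiv (j, 1)) : ℕ)) * (F x : ℂ)), mul_assoc]
  simp only [integral_skew_monomial hrad hint]
  rw [Finset.prod_mul_distrib]
  by_cases hadj : ∀ j : Fin N,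
      ((σ (finProdFinEquiv (j, 0)) : ℕ) + 1 = σ (finProdFinEquiv (j, 1)) ∨
        (σ (finProdFinEquiv (j, 1)) : ℕ) + 1 = σ (finProdFinEquiv (j, 0)))
  · have hinj : ∀ {p q : Fin N × Fin 2},
        (σ (finProdFinEquiv p) : ℕ) = σ (finProdFinEquiv q) → p = q := fun h =>
      finProdFinEquiv.injective (σ.injective (Fin.ext h))
    rw [prod_max_of_adjacent (x := fun j => (σ (finProdFinEquiv (j, 0)) : ℕ))
      (y := fun j => (σ (finProdFinEquiv (j, 1)) : ℕ))
      (fun j k h => congrArg Prod.fst (hinj h)) (fun j k h => congrArg Prod.fst (hinj h))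
      (fun j k h => zero_ne_one (congrArg Prod.snd (hinj h)))
      (fun n hn => ?_) (fun j => (σ _).2) (fun j => (σ _).2) hadj
      (fun n => ((∫ z, ‖z‖ ^ (2 * n) * F z ∂areaMeasure : ℝ) : ℂ))]
    obtain ⟨⟨j, s⟩, hp⟩ := finProdFinEquiv.surjective (σ.symm ⟨n, hn⟩)
    have hn' : (σ (finProdFinEquiv (j, s)) : ℕ) = n := by simp [hp]
    refine ⟨j, ?_⟩
    fin_cases s
    · exact Or.inl hn'
    · exact Or.inr hn'
  · push Not at hadj
    obtain ⟨j, hj⟩ := hadj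
    have h0 : ∏ j : Fin N, adjacencySign (σ (finProdFinEquiv (j, 0)))
        (σ (finProdFinEquiv (j, 1))) = 0 :=
      Finset.prod_eq_zero (Finset.mem_univ j) (by rw [adjacencySign, if_neg hj.1, if_neg hj.2])
    rw [h0, zero_mul, zero_mul]

/-! ### Factorisation of the interaction integral -/

namespace PlanarEnsemble

/-- Half the exponent of the radial moment attached to the `k`-th point: `k` for `β = 2` and
`2k + 1` for `β = 4`. -/
def momentIndex : PlanarEnsemble → ℕ → ℕ
  | complex, k => k
  | symplectic, k => 2 * k + 1

theorem two_mul_momentIndex_add_two (𝓔 : PlanarEnsemble) (k : ℕ) :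
    (2 * 𝓔.momentIndex k + 2 : ℝ) = 𝓔.beta * (k + 1) := by
  cases 𝓔 <;> simp only [momentIndex, beta] <;> push_cast <;> ring

theorem beta_pos (𝓔 : PlanarEnsemble) : 0 < 𝓔.beta := by
  cases 𝓔 <;> simp [beta]

theorem interaction_nonneg (𝓔 : PlanarEnsemble) {N : ℕ} (z : Fin N → ℂ) :
    0 ≤ 𝓔.interaction z := by
  cases 𝓔 <;> simp only [interaction] <;> positivity

theorem continuous_interaction (𝓔 : PlanarEnsemble) (N : ℕ) :
    Continuous fun z : Fin N → ℂ => 𝓔.interaction z := by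
  cases 𝓔 <;> simp only [interaction] <;> fun_prop

end PlanarEnsemble

/-- The moment `∫ |z| ^ (2b) F(z) dA(z)`, with values in `[0, ∞]`. -/
noncomputable def radialMoment (F : ℂ → ℝ) (b : ℕ) : ENNReal :=
  ∫⁻ z, ENNReal.ofReal (‖z‖ ^ (2 * b) * F z) ∂areaMeasure

theorem exists_integral_interaction (𝓔 : PlanarEnsemble) (N : ℕ) :
    ∃ C : ℂ, ∀ F : ℂ → ℝ, (∀ z w : ℂ, ‖z‖ = ‖w‖ → F z = F w) →
      (∀ a b : ℕ, Integrable (fun z : ℂ => z ^ a * star z ^ b * (F z : ℂ)) areaMeasure) →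
      Integrable (fun z : Fin N → ℂ => ((𝓔.interaction z * ∏ j, F (z j) : ℝ) : ℂ))
        (Measure.pi fun _ => areaMeasure) ∧
      ∫ z : Fin N → ℂ, ((𝓔.interaction z * ∏ j, F (z j) : ℝ) : ℂ)
        ∂(Measure.pi fun _ => areaMeasure)
      = C * ∏ k : Fin N,
          ((∫ z, ‖z‖ ^ (2 * 𝓔.momentIndex k) * F z ∂areaMeasure : ℝ) : ℂ) := by
  cases 𝓔
  · exact ⟨_, fun F h1 h2 => integral_interaction_complex h1 h2⟩
  · exact ⟨_, fun F h1 h2 => integral_interaction_symplectic h1 h2⟩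

theorem exists_lintegral_interaction_of_integrable (𝓔 : PlanarEnsemble) (N : ℕ) :
    ∃ C : ℝ, ∀ F : ℂ → ℝ, (∀ z w : ℂ, ‖z‖ = ‖w‖ → F z = F w) → (∀ z, 0 ≤ F z) →
      (∀ a b : ℕ, Integrable (fun z : ℂ => z ^ a * star z ^ b * (F z : ℂ)) areaMeasure) →
      ∫⁻ z : Fin N → ℂ, ENNReal.ofReal (𝓔.interaction z * ∏ j, F (z j))
        ∂(Measure.pi fun _ => areaMeasure)
      = ENNReal.ofReal C * ∏ k : Fin N, radialMoment F (𝓔.momentIndex k) := by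
  obtain ⟨C, hC⟩ := exists_integral_interaction 𝓔 N
  refine ⟨C.re, fun F hrad hF hint => ?_⟩
  obtain ⟨h1, h2⟩ := hC F hrad hint
  have h1' : Integrable (fun z : Fin N → ℂ => 𝓔.interaction z * ∏ j, F (z j))
      (Measure.pi fun _ => areaMeasure) := by
    refine h1.re.congr (Eventually.of_forall fun z => ?_)
    exact Complex.ofReal_re _
  have hmom : ∀ b, radialMoment F b
      = ENNReal.ofReal (∫ z, ‖z‖ ^ (2 * b) * F z ∂areaMeasure) := by
    intro b
    refine (ofReal_integral_eq_lintegral_ofReal ?_ (Eventually.of_forall fun z =>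
      mul_nonneg (by positivity) (hF z))).symm
    refine (hint b b).re.congr (Eventually.of_forall fun z => ?_)
    simp only [RCLike.re_eq_complex_re]
    rw [← mul_pow, RCLike.star_def, Complex.mul_conj, Complex.normSq_eq_norm_sq,
      ← Complex.ofReal_pow, ← Complex.ofReal_mul, Complex.ofReal_re, pow_mul]
  have hnn : ∀ b : ℕ, 0 ≤ ∫ z, ‖z‖ ^ (2 * b) * F z ∂areaMeasure := fun b =>
    integral_nonneg fun z => mul_nonneg (by positivity) (hF z)
  rw [← ofReal_integral_eq_lintegral_ofReal h1' (Eventually.of_forall fun z =>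
      mul_nonneg (𝓔.interaction_nonneg z) (Finset.prod_nonneg fun j _ => hF _))]
  simp only [hmom]
  rw [← ENNReal.ofReal_prod_of_nonneg fun k _ => hnn _,
    ← ENNReal.ofReal_mul' (Finset.prod_nonneg fun k _ => hnn _)]
  congr 1
  rw [integral_complex_ofReal, ← Complex.ofReal_prod] at h2
  have h3 := congrArg Complex.re h2
  rwa [Complex.ofReal_re, Complex.re_mul_ofReal] at h3

/-! ### Weights with possibly infinite moments -/

/-- The truncation of `F` at height `n` and to the disc of radius `n`. -/
noncomputable def truncate (F : ℂ → ℝ) (n : ℕ) (z : ℂ) : ℝ :=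
  if ‖z‖ ≤ n then min (F z) n else 0

theorem truncate_nonneg {F : ℂ → ℝ} (hF : ∀ z, 0 ≤ F z) (n : ℕ) (z : ℂ) : 0 ≤ truncate F n z := by
  rw [truncate]
  split_ifs
  exacts [le_min (hF z) n.cast_nonneg, le_rfl]

theorem measurable_truncate {F : ℂ → ℝ} (hF : Measurable F) (n : ℕ) : Measurable (truncate F n) :=
  Measurable.ite (measurableSet_le measurable_norm measurable_const) (hF.min measurable_const)
    measurable_const

theorem truncate_monotone {F : ℂ → ℝ} (hF : ∀ z, 0 ≤ F z) (z : ℂ) :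
    Monotone fun n => truncate F n z := by
  intro m n hmn
  have h : (m : ℝ) ≤ n := by exact_mod_cast hmn
  simp only [truncate]
  split_ifs with h1 h2
  · exact min_le_min_left _ h
  · exact absurd (h1.trans h) h2
  · exact le_min (hF z) n.cast_nonneg
  · exact le_rfl

theorem truncate_eventually_eq (F : ℂ → ℝ) (z : ℂ) :
    ∀ᶠ n : ℕ in atTop, truncate F n z = F z := by
  filter_upwards [(tendsto_natCast_atTop_atTop (R := ℝ)).eventually_ge_atTop ‖z‖,
    (tendsto_natCast_atTop_atTop (R := ℝ)).eventually_ge_atTop (F z)] with n h1 h2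
  simp [truncate, h1, h2]

theorem integrable_monomial_truncate {F : ℂ → ℝ} (hF : ∀ z, 0 ≤ F z) (hm : Measurable F)
    (n a b : ℕ) :
    Integrable (fun z : ℂ => z ^ a * star z ^ b * (truncate F n z : ℂ)) areaMeasure := by
  have h : (fun z : ℂ => z ^ a * star z ^ b * (truncate F n z : ℂ))
      = (Metric.closedBall (0 : ℂ) n).indicator
          fun z : ℂ => z ^ a * star z ^ b * (truncate F n z : ℂ) := by
    ext z
    by_cases hz : z ∈ Metric.closedBall (0 : ℂ) n
    · rw [Set.indicator_of_mem hz]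
    · rw [Set.indicator_of_notMem hz, truncate, if_neg (by simpa using hz)]
      simp
  rw [h, integrable_indicator_iff Metric.isClosed_closedBall.measurableSet]
  have hfin : areaMeasure (Metric.closedBall (0 : ℂ) n) ≠ ⊤ := by
    rw [areaMeasure, Measure.smul_apply, smul_eq_mul]
    exact ENNReal.mul_ne_top ENNReal.ofReal_ne_top measure_closedBall_lt_top.ne
  refine Measure.integrableOn_of_bounded (M := (n : ℝ) ^ a * (n : ℝ) ^ b * n) hfin ?_ ?_
  · have := measurable_truncate hm n
    have h2 : Measurable fun z : ℂ => (star z : ℂ) := continuous_star.measurable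
    exact (((measurable_id.pow_const a).mul (h2.pow_const b)).mul
      (Complex.measurable_ofReal.comp this)).aestronglyMeasurable
  · refine (ae_restrict_iff' Metric.isClosed_closedBall.measurableSet).2
      (Eventually.of_forall fun z hz => ?_)
    have hz' : ‖z‖ ≤ n := by simpa using hz
    have h1 : truncate F n z ≤ n := by
      rw [truncate, if_pos hz']
      exact min_le_right _ _
    rw [norm_mul, norm_mul, norm_pow, norm_pow, norm_star, Complex.norm_real, Real.norm_eq_abs,
      abs_of_nonneg (truncate_nonneg hF n z)]
    gcongr
    exact truncate_nonneg hF n z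

theorem tendsto_radialMoment_truncate {F : ℂ → ℝ} (hF : ∀ z, 0 ≤ F z) (hm : Measurable F)
    (b : ℕ) :
    Tendsto (fun n => radialMoment (truncate F n) b) atTop (𝓝 (radialMoment F b)) := by
  refine lintegral_tendsto_of_tendsto_of_monotone (fun n => ?_) (Eventually.of_forall fun z => ?_)
    (Eventually.of_forall fun z => ?_)
  · exact (((measurable_norm.pow_const _).mul (measurable_truncate hm n)).ennreal_ofReal).aemeasurable
  · intro m n hmn
    exact ENNReal.ofReal_le_ofReal
      (mul_le_mul_of_nonneg_left (truncate_monotone hF z hmn) (by positivity))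
  · refine tendsto_const_nhds.congr' ?_
    filter_upwards [truncate_eventually_eq F z] with n hn
    rw [hn]

theorem radialMoment_ne_zero {F : ℂ → ℝ} (hF : ∀ z, 0 < F z) (hm : Measurable F) (b : ℕ) :
    radialMoment F b ≠ 0 := by
  intro h
  have hmeas : Measurable fun z : ℂ => ENNReal.ofReal (‖z‖ ^ (2 * b) * F z) :=
    ((measurable_norm.pow_const _).mul hm).ennreal_ofReal
  rw [radialMoment, lintegral_eq_zero_iff hmeas] at h
  have hA : areaMeasure {z : ℂ | z ≠ 0} = 0 := by
    refine measure_mono_null (fun z hz => ?_) (ae_iff.1 h)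
    have hz : 0 < ‖z‖ := norm_pos_iff.2 hz
    have : 0 < ‖z‖ ^ (2 * b) * F z := mul_pos (by positivity) (hF z)
    exact (ENNReal.ofReal_pos.2 this).ne'
  rw [areaMeasure, Measure.smul_apply, smul_eq_mul, mul_eq_zero] at hA
  rcases hA with hA | hA
  · exact absurd (ENNReal.ofReal_eq_zero.1 hA) (not_le.2 (by positivity))
  · exact (isOpen_ne.measure_pos volume ⟨(1 : ℂ), one_ne_zero⟩).ne' hA

/-- For a positive radial weight the integral of the interaction factorises into radial moments,
up to a constant that does not depend on the weight; both sides may be infinite. -/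
theorem exists_lintegral_interaction (𝓔 : PlanarEnsemble) (N : ℕ) :
    ∃ C : ℝ, ∀ F : ℂ → ℝ, (∀ z w : ℂ, ‖z‖ = ‖w‖ → F z = F w) → (∀ z, 0 < F z) → Measurable F →
      ∫⁻ z : Fin N → ℂ, ENNReal.ofReal (𝓔.interaction z * ∏ j, F (z j))
        ∂(Measure.pi fun _ => areaMeasure)
      = ENNReal.ofReal C * ∏ k : Fin N, radialMoment F (𝓔.momentIndex k) := by
  obtain ⟨C, hC⟩ := exists_lintegral_interaction_of_integrable 𝓔 N
  refine ⟨C, fun F hrad hpos hm => ?_⟩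
  have hF : ∀ z, 0 ≤ F z := fun z => (hpos z).le
  have htr : ∀ n, ∀ z w : ℂ, ‖z‖ = ‖w‖ → truncate F n z = truncate F n w := by
    intro n z w hzw
    simp only [truncate, hzw, hrad z w hzw]
  have hlhs : Tendsto (fun n => ∫⁻ z : Fin N → ℂ,
      ENNReal.ofReal (𝓔.interaction z * ∏ j, truncate F n (z j))
        ∂(Measure.pi fun _ => areaMeasure)) atTop
      (𝓝 (∫⁻ z : Fin N → ℂ, ENNReal.ofReal (𝓔.interaction z * ∏ j, F (z j))
        ∂(Measure.pi fun _ => areaMeasure))) := by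
    refine lintegral_tendsto_of_tendsto_of_monotone (fun n => ?_)
      (Eventually.of_forall fun z => ?_) (Eventually.of_forall fun z => ?_)
    · refine Measurable.aemeasurable (Measurable.ennreal_ofReal ?_)
      exact (𝓔.continuous_interaction N).measurable.mul (Finset.measurable_prod _ fun j _ =>
        (measurable_truncate hm n).comp (measurable_pi_apply j))
    · intro m n hmn
      exact ENNReal.ofReal_le_ofReal (mul_le_mul_of_nonneg_left
        (Finset.prod_le_prod (fun j _ => truncate_nonneg hF m _)
          fun j _ => truncate_monotone hF (z j) hmn) (𝓔.interaction_nonneg z))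
    · refine tendsto_const_nhds.congr' ?_
      filter_upwards [eventually_all.2 fun j => truncate_eventually_eq F (z j)] with n hn
      simp only [hn]
  have hprod : Tendsto (fun n => ∏ k : Fin N, radialMoment (truncate F n) (𝓔.momentIndex k)) atTop
      (𝓝 (∏ k : Fin N, radialMoment F (𝓔.momentIndex k))) := by
    -- Positivity of the limits makes multiplication continuous there, even at infinite moments.
    have hne := fun b => radialMoment_ne_zero hpos hm b
    have key : ∀ s : Finset (Fin N),
        Tendsto (fun n => ∏ k ∈ s, radialMoment (truncate F n) (𝓔.momentIndex k)) atTop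
          (𝓝 (∏ k ∈ s, radialMoment F (𝓔.momentIndex k))) := by
      intro s
      induction s using Finset.induction_on with
      | empty => simp
      | insert k s hk ih =>
        simp only [Finset.prod_insert hk]
        exact ENNReal.Tendsto.mul (tendsto_radialMoment_truncate hF hm _) (Or.inl (hne _)) ih
          (Or.inl (Finset.prod_ne_zero_iff.2 fun k _ => hne _))
    exact key Finset.univ
  refine tendsto_nhds_unique hlhs ?_
  simp only [fun n => hC (truncate F n) (htr n) (truncate_nonneg hF n)
    (integrable_monomial_truncate hF hm n)]
  exact ENNReal.Tendsto.const_mul hprod (Or.inr ENNReal.ofReal_ne_top)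

/-! ### Exponential Markov bound -/

theorem radialMoment_add {F G : ℂ → ℝ} (hF : ∀ z, 0 ≤ F z) (hG : ∀ z, 0 ≤ G z)
    (hm : Measurable F) (b : ℕ) :
    radialMoment (fun z => F z + G z) b = radialMoment F b + radialMoment G b := by
  have hmeas : Measurable fun z : ℂ => ENNReal.ofReal (‖z‖ ^ (2 * b) * F z) :=
    ((measurable_norm.pow_const _).mul hm).ennreal_ofReal
  rw [radialMoment, radialMoment, radialMoment, ← lintegral_add_left hmeas]
  refine lintegral_congr fun z => ?_
  rw [mul_add, ENNReal.ofReal_add (mul_nonneg (by positivity) (hF z))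
    (mul_nonneg (by positivity) (hG z))]

/-- Exponential Markov bound for the number of points with modulus in `{r | p r}`: if the `k`-th
radial density gives this set conditional mass at most `η` for every `k ∉ B`, then the number of
points is unlikely to exceed `B.card`. -/
theorem gibbsLaw_count_ge_le (𝓔 : PlanarEnsemble) {g : ℝ → ℝ} {N : ℕ}
    (hg : Measurable (radialPotential g)) (p : ℝ → Prop) [DecidablePred p]
    (hp : MeasurableSet {r | p r}) (B : Finset (Fin N)) {η : ℝ} (hη : 0 ≤ η)
    (hB : ∀ k : Fin N, k ∉ B →
      radialMoment (fun z => if p ‖z‖ then Real.exp (-(N * radialPotential g z)) else 0)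
          (𝓔.momentIndex k)
        ≤ ENNReal.ofReal η *
          radialMoment (fun z => Real.exp (-(N * radialPotential g z))) (𝓔.momentIndex k))
    (x : ℝ) :
    gibbsLaw 𝓔 g N {z | x ≤ (((Finset.univ.filter fun j => p ‖z j‖).card : ℕ) : ℝ)}
      ≤ ENNReal.ofReal ((2 : ℝ) ^ ((B.card : ℝ) - x) * (1 + η) ^ N) := by
  obtain ⟨C, hC⟩ := exists_lintegral_interaction 𝓔 N
  set F : ℂ → ℝ := fun z => Real.exp (-(N * radialPotential g z)) with hFdef
  set G : ℂ → ℝ := fun z => if p ‖z‖ then F z else 0 with hGdef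
  have hFpos : ∀ z, 0 < F z := fun z => Real.exp_pos _
  have hFm : Measurable F := Real.measurable_exp.comp (measurable_const.mul hg).neg
  have hFrad : ∀ z w : ℂ, ‖z‖ = ‖w‖ → F z = F w := by
    intro z w hzw
    simp only [hFdef, radialPotential, hzw]
  have hGnn : ∀ z, 0 ≤ G z := by
    intro z
    simp only [hGdef]
    split_ifs
    exacts [(hFpos z).le, le_rfl]
  have hGm : Measurable G := Measurable.ite (measurable_norm hp) hFm measurable_const
  have hFGpos : ∀ z, 0 < F z + G z := fun z => add_pos_of_pos_of_nonneg (hFpos z) (hGnn z)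
  have hFGrad : ∀ z w : ℂ, ‖z‖ = ‖w‖ → F z + G z = F w + G w := by
    intro z w hzw
    simp only [hGdef, hFrad z w hzw, hzw]
  have hZ : partitionFunction 𝓔 g N
      = ENNReal.ofReal C * ∏ k : Fin N, radialMoment F (𝓔.momentIndex k) :=
    hC F hFrad hFpos hFm
  have hZ' := hC (fun z => F z + G z) hFGrad hFGpos (hFm.add hGm)
  -- The weight `F + G` charges each point with `p ‖z‖` by a factor of two.
  have hcount : ∀ z : Fin N → ℂ, ∏ j, (F (z j) + G (z j))
      = (2 : ℝ) ^ (Finset.univ.filter fun j => p ‖z j‖).card * ∏ j, F (z j) := by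
    intro z
    rw [← Finset.prod_const, Finset.prod_filter, ← Finset.prod_mul_distrib]
    refine Finset.prod_congr rfl fun j _ => ?_
    simp only [hGdef]
    split_ifs <;> ring
  set A : Set (Fin N → ℂ) := {z | x ≤ (((Finset.univ.filter fun j => p ‖z j‖).card : ℕ) : ℝ)}
    with hA
  have hmarkov : ∫⁻ z in A, ENNReal.ofReal (gibbsWeight 𝓔 g N z)
        ∂(Measure.pi fun _ : Fin N => areaMeasure)
      ≤ ENNReal.ofReal ((2 : ℝ) ^ (-x)) *
        ∫⁻ z : Fin N → ℂ, ENNReal.ofReal (𝓔.interaction z * ∏ j, (F (z j) + G (z j)))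
          ∂(Measure.pi fun _ => areaMeasure) := by
    rw [← lintegral_const_mul' _ _ ENNReal.ofReal_ne_top]
    refine (setLIntegral_mono' ?_ fun z hz => ?_).trans (setLIntegral_le_lintegral A _)
    · have hcard : Measurable fun z : Fin N → ℂ =>
          (((Finset.univ.filter fun j => p ‖z j‖).card : ℕ) : ℝ) := by
        simp only [Finset.card_filter, Nat.cast_sum]
        refine Finset.measurable_sum _ fun j _ => ?_
        refine (measurable_from_nat (f := fun n : ℕ => (n : ℝ))).comp
          (Measurable.ite ?_ measurable_const measurable_const)
        exact (measurable_norm.comp (measurable_pi_apply j)) hp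
      exact measurableSet_le measurable_const hcard
    · rw [← ENNReal.ofReal_mul (by positivity), hcount]
      refine ENNReal.ofReal_le_ofReal ?_
      have h1 : (1 : ℝ) ≤ (2 : ℝ) ^ (-x) *
          (2 : ℝ) ^ (Finset.univ.filter fun j => p ‖z j‖).card := by
        rw [← Real.rpow_natCast, ← Real.rpow_add two_pos]
        refine Real.one_le_rpow one_le_two ?_
        have hz' : x ≤ (((Finset.univ.filter fun j => p ‖z j‖).card : ℕ) : ℝ) := hz
        linarith
      have h2 : 0 ≤ 𝓔.interaction z * ∏ j, F (z j) :=
        mul_nonneg (𝓔.interaction_nonneg z) (Finset.prod_nonneg fun j _ => (hFpos _).le)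
      calc gibbsWeight 𝓔 g N z = 1 * (𝓔.interaction z * ∏ j, F (z j)) := (one_mul _).symm
        _ ≤ _ := mul_le_mul_of_nonneg_right h1 h2
        _ = _ := by ring
  have hfactor : ∀ k : Fin N, radialMoment (fun z => F z + G z) (𝓔.momentIndex k)
      ≤ (if k ∈ B then ENNReal.ofReal 2 else 1) * ENNReal.ofReal (1 + η) *
        radialMoment F (𝓔.momentIndex k) := by
    intro k
    rw [radialMoment_add (fun z => (hFpos z).le) hGnn hFm]
    split_ifs with hk
    · have h1 : radialMoment G (𝓔.momentIndex k) ≤ radialMoment F (𝓔.momentIndex k) := by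
        refine lintegral_mono fun z => ENNReal.ofReal_le_ofReal
          (mul_le_mul_of_nonneg_left ?_ (by positivity))
        simp only [hGdef]
        split_ifs
        exacts [le_rfl, (hFpos z).le]
      calc _ ≤ radialMoment F (𝓔.momentIndex k) + radialMoment F (𝓔.momentIndex k) := by gcongr
        _ = ENNReal.ofReal 2 * 1 * radialMoment F (𝓔.momentIndex k) := by
          rw [ENNReal.ofReal_ofNat, mul_one, two_mul]
        _ ≤ _ := by
          gcongr
          rw [← ENNReal.ofReal_one]
          exact ENNReal.ofReal_le_ofReal (by linarith)
    · calc _ ≤ radialMoment F (𝓔.momentIndex k) +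
            ENNReal.ofReal η * radialMoment F (𝓔.momentIndex k) := by gcongr; exact hB k hk
        _ = _ := by rw [ENNReal.ofReal_add zero_le_one hη, ENNReal.ofReal_one]; ring
  have hconst : ∏ k : Fin N, ((if k ∈ B then ENNReal.ofReal 2 else 1) * ENNReal.ofReal (1 + η))
      = ENNReal.ofReal ((2 : ℝ) ^ B.card * (1 + η) ^ N) := by
    rw [Finset.prod_mul_distrib, Finset.prod_const, Finset.card_univ, Fintype.card_fin,
      Finset.prod_ite_mem, Finset.univ_inter, Finset.prod_const,
      ENNReal.ofReal_mul (by positivity), ENNReal.ofReal_pow zero_le_two,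
      ENNReal.ofReal_pow (by positivity)]
  calc gibbsLaw 𝓔 g N A
      = (partitionFunction 𝓔 g N)⁻¹ * ∫⁻ z in A, ENNReal.ofReal (gibbsWeight 𝓔 g N z)
        ∂(Measure.pi fun _ : Fin N => areaMeasure) := by
        rw [gibbsLaw, Measure.smul_apply, smul_eq_mul, withDensity_apply' _ A]
    _ ≤ (partitionFunction 𝓔 g N)⁻¹ * (ENNReal.ofReal ((2 : ℝ) ^ (-x)) *
        (ENNReal.ofReal C * ∏ k : Fin N,
          ((if k ∈ B then ENNReal.ofReal 2 else 1) * ENNReal.ofReal (1 + η) *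
            radialMoment F (𝓔.momentIndex k)))) := by
        refine mul_le_mul_right (hmarkov.trans ?_) _
        rw [hZ']
        gcongr with k
        exact hfactor k
    _ = ((partitionFunction 𝓔 g N)⁻¹ * partitionFunction 𝓔 g N) *
        ENNReal.ofReal ((2 : ℝ) ^ ((B.card : ℝ) - x) * (1 + η) ^ N) := by
        rw [Finset.prod_mul_distrib, hconst, sub_eq_neg_add, Real.rpow_add two_pos,
          Real.rpow_natCast, mul_assoc ((2 : ℝ) ^ (-x)),
          ENNReal.ofReal_mul (p := (2 : ℝ) ^ (-x)) (by positivity)]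
        conv_rhs => rw [mul_assoc, hZ]
        rw [hZ]
        ring
    _ ≤ _ := by
        -- In `[0, ∞]` this holds for every `Z`: where `Z = 0` or `Z = ∞`, the product is `0`.
        exact mul_le_of_le_one_left zero_le (ENNReal.inv_mul_le_one _)

/-! ### Dilation of the radial densities -/

theorem lintegral_comp_smul_areaMeasure {c : ℝ} (hc : 0 < c) {f : ℂ → ENNReal}
    (hf : Measurable f) :
    ∫⁻ z, f (c • z) ∂areaMeasure = ENNReal.ofReal ((c ^ 2)⁻¹) * ∫⁻ z, f z ∂areaMeasure := by
  rw [areaMeasure, lintegral_smul_measure, lintegral_smul_measure,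
    ← lintegral_map hf (measurable_const_smul c), Measure.map_addHaar_smul _ hc.ne',
    lintegral_smul_measure, Complex.finrank_real_complex, abs_of_pos (by positivity)]
  simp only [smul_eq_mul]
  ring

theorem ae_ne_zero_areaMeasure : ∀ᵐ z ∂areaMeasure, z ≠ 0 := by
  rw [ae_iff]
  simp [areaMeasure]

/-- Comparison of a radial density with its dilation by `exp h`: where the dilation gains a factor
`exp (N κ)`, the density has small mass. -/
theorem radialMoment_restrict_le {g : ℝ → ℝ} {N : ℕ} (hg : Measurable (radialPotential g))
    (p : ℝ → Prop) [DecidablePred p] (b : ℕ) (h κ : ℝ)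
    (hgain : ∀ r, 0 < r → p r →
      N * (g (Real.exp h * r) - g r) + N * κ ≤ (2 * b + 2) * h) :
    radialMoment (fun z => if p ‖z‖ then Real.exp (-(N * radialPotential g z)) else 0) b
      ≤ ENNReal.ofReal (Real.exp (-(N * κ))) *
        radialMoment (fun z => Real.exp (-(N * radialPotential g z))) b := by
  set F : ℂ → ℝ := fun z => Real.exp (-(N * radialPotential g z)) with hFdef
  have hFm : Measurable F := Real.measurable_exp.comp (measurable_const.mul hg).neg
  set c := Real.exp h with hc
  have hcpos : 0 < c := Real.exp_pos h
  have hm : Measurable fun z : ℂ => ENNReal.ofReal (‖z‖ ^ (2 * b) * F z) :=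
    ((measurable_norm.pow_const _).mul hFm).ennreal_ofReal
  have hpt : ∀ᵐ z ∂areaMeasure,
      ENNReal.ofReal (‖z‖ ^ (2 * b) * (if p ‖z‖ then F z else 0))
        ≤ ENNReal.ofReal (Real.exp (-(N * κ)) * c ^ 2) *
          ENNReal.ofReal (‖c • z‖ ^ (2 * b) * F (c • z)) := by
    filter_upwards [ae_ne_zero_areaMeasure] with z hz
    rw [← ENNReal.ofReal_mul (by positivity)]
    refine ENNReal.ofReal_le_ofReal ?_
    split_ifs with hpz
    · have hg1 := hgain ‖z‖ (norm_pos_iff.2 hz) hpz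
      have hnorm : ‖c • z‖ = c * ‖z‖ := by
        rw [norm_smul, Real.norm_eq_abs, abs_of_pos hcpos]
      have hexp : F z ≤ Real.exp (-(N * κ)) * c ^ (2 * b + 2) * F (c • z) := by
        simp only [hFdef, radialPotential, hnorm]
        rw [hc, ← Real.exp_nat_mul, ← Real.exp_add, ← Real.exp_add, Real.exp_le_exp]
        push_cast
        linarith
      calc ‖z‖ ^ (2 * b) * F z
          ≤ ‖z‖ ^ (2 * b) * (Real.exp (-(N * κ)) * c ^ (2 * b + 2) * F (c • z)) := by gcongr
        _ = _ := by rw [hnorm]; ring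
    · rw [mul_zero]
      have : 0 < F (c • z) := Real.exp_pos _
      positivity
  calc _ ≤ ∫⁻ z, ENNReal.ofReal (Real.exp (-(N * κ)) * c ^ 2) *
          ENNReal.ofReal (‖c • z‖ ^ (2 * b) * F (c • z)) ∂areaMeasure := lintegral_mono_ae hpt
    _ = ENNReal.ofReal (Real.exp (-(N * κ)) * c ^ 2) *
          (ENNReal.ofReal ((c ^ 2)⁻¹) * radialMoment F b) := by
        rw [lintegral_const_mul' _ _ ENNReal.ofReal_ne_top, lintegral_comp_smul_areaMeasure hcpos hm]
        rfl
    _ = _ := by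
        rw [← mul_assoc, ← ENNReal.ofReal_mul (by positivity),
          mul_inv_cancel_right₀ (by positivity)]

/-! ### Convexity of the potential in `log r` -/

theorem measurable_radialPotential {g : ℝ → ℝ} (hg : DifferentiableOn ℝ g (Set.Ioi 0)) :
    Measurable (radialPotential g) := by
  refine measurable_of_continuousOn_compl_singleton 0 ?_
  exact hg.continuousOn.comp continuous_norm.continuousOn fun z hz => norm_pos_iff.2 hz

/-- In the variable `log r` the potential is convex, so its increments over a fixed distance
increase. -/
theorem monotoneOn_dilation_sub {g : ℝ → ℝ} (hg : DifferentiableOn ℝ g (Set.Ioi 0))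
    (hmono : MonotoneOn (fun r => r * deriv g r) (Set.Ioi 0)) {c : ℝ} (hc : 1 ≤ c) :
    MonotoneOn (fun r => g (c * r) - g r) (Set.Ioi 0) := by
  have hd : ∀ r ∈ Set.Ioi (0 : ℝ),
      HasDerivAt (fun r => g (c * r) - g r) (c * deriv g (c * r) - deriv g r) r := by
    intro r hr
    have hr : 0 < r := hr
    have h1 : HasDerivAt g (deriv g (c * r)) (c * r) :=
      (hg.differentiableAt (Ioi_mem_nhds (by positivity))).hasDerivAt
    have h2 : HasDerivAt g (deriv g r) r := (hg.differentiableAt (Ioi_mem_nhds hr)).hasDerivAt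
    have h3 : HasDerivAt (fun r => c * r) c r := by simpa using (hasDerivAt_id r).const_mul c
    rw [mul_comm c]
    exact (h1.comp r h3).sub h2
  refine monotoneOn_of_deriv_nonneg (convex_Ioi 0)
    (fun r hr => (hd r hr).continuousAt.continuousWithinAt) ?_ ?_
  · intro r hr
    rw [interior_Ioi] at hr
    exact (hd r hr).differentiableAt.differentiableWithinAt
  · intro r hr
    rw [interior_Ioi] at hr
    have hr' : 0 < r := hr
    rw [(hd r hr).deriv]
    have h := hmono hr (show c * r ∈ Set.Ioi (0 : ℝ) from mul_pos (by linarith) hr')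
      (le_mul_of_one_le_left hr'.le hc)
    have h4 : 0 ≤ r * (c * deriv g (c * r) - deriv g r) := by
      simp only at h
      linarith
    exact nonneg_of_mul_nonneg_right h4 hr'

theorem hasDerivAt_comp_exp_mul {g : ℝ → ℝ} {r : ℝ} (hg : DifferentiableAt ℝ g r) :
    HasDerivAt (fun h => g (Real.exp h * r)) (r * deriv g r) 0 := by
  have h1 : HasDerivAt (fun h => Real.exp h * r) r 0 := by
    simpa using (Real.hasDerivAt_exp 0).mul_const r
  have h2 : HasDerivAt g (deriv g r) (Real.exp 0 * r) := by simpa using hg.hasDerivAt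
  simpa [mul_comm, Function.comp_def] using h2.comp 0 h1

namespace SuitablePotential

variable {β : ℝ} {gN : ℕ → ℝ → ℝ} {g : ℝ → ℝ}

theorem monotoneOn_dilation_sub_limit (hQ : SuitablePotential β gN g) {c : ℝ} (hc : 1 ≤ c) :
    MonotoneOn (fun r => g (c * r) - g r) (Set.Ioi 0) := by
  intro r hr s hs hrs
  have hr' : 0 < r := hr
  have hs' : 0 < s := hs
  have hlim : ∀ t, 0 < t → Tendsto (fun N => gN N (c * t) - gN N t) atTop (𝓝 (g (c * t) - g t)) :=
    fun t ht => (hQ.tendsto_limit _ (by positivity)).sub (hQ.tendsto_limit t ht)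
  refine le_of_tendsto_of_tendsto (hlim r hr') (hlim s hs') ?_
  filter_upwards [eventually_ge_atTop 1] with N hN
  exact monotoneOn_dilation_sub (hQ.differentiableOn N hN) (hQ.strictMonoOn N hN).monotoneOn hc
    hr hs hrs

/-- The limit inherits from `gN` that `r g'(r)` increases. -/
theorem monotoneOn_mul_deriv (hQ : SuitablePotential β gN g) :
    MonotoneOn (fun r => r * deriv g r) (Set.Ioc 0 1) := by
  intro r hr s hs hrs
  have h1 := (hasDerivAt_comp_exp_mul (hQ.limit_differentiableAt r hr)).tendsto_slope_zero_right
  have h2 := (hasDerivAt_comp_exp_mul (hQ.limit_differentiableAt s hs)).tendsto_slope_zero_right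
  refine le_of_tendsto_of_tendsto h1 h2 ?_
  filter_upwards [self_mem_nhdsWithin] with h hh
  have hh' : 0 < h := hh
  have := hQ.monotoneOn_dilation_sub_limit (Real.one_le_exp hh'.le) hr.1 hs.1 hrs
  simp only [zero_add, Real.exp_zero, one_mul, smul_eq_mul]
  exact mul_le_mul_of_nonneg_left this (by positivity)

theorem mul_deriv_le (hQ : SuitablePotential β gN g) {a : ℝ} (ha : a ∈ Set.Ioc (0 : ℝ) 1) :
    a * deriv g a ≤ β := by
  simpa [hQ.limit_edge] using hQ.monotoneOn_mul_deriv ha (Set.right_mem_Ioc.2 one_pos) ha.2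

theorem mul_deriv_nonneg (hQ : SuitablePotential β gN g) {a : ℝ} (ha : a ∈ Set.Ioc (0 : ℝ) 1) :
    0 ≤ a * deriv g a := by
  refine le_of_tendsto hQ.limit_origin ?_
  filter_upwards [Ioo_mem_nhdsGT ha.1] with r hr
  exact hQ.monotoneOn_mul_deriv ⟨hr.1, hr.2.le.trans ha.2⟩ ha hr.2.le

/-- Convexity turns pointwise convergence into convergence of difference quotients at a fixed scale
`h`, uniformly on either side of `a`. -/
theorem exists_scale (hQ : SuitablePotential β gN g) {a : ℝ} (ha : a ∈ Set.Ioc (0 : ℝ) 1)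
    {δ : ℝ} (hδ : 0 < δ) :
    ∃ h, 0 < h ∧ ∀ᶠ N in atTop,
      (∀ r, 0 < r → r < a →
        gN N (Real.exp h * r) - gN N r ≤ (a * deriv g a + δ) * h) ∧
      ∀ r, a ≤ r → gN N (Real.exp (-h) * r) - gN N r ≤ (a * deriv g a - δ) * (-h) := by
  have ha0 : 0 < a := ha.1
  have hder := hasDerivAt_comp_exp_mul (hQ.limit_differentiableAt a ha)
  have hsmall := (hasDerivAt_iff_isLittleO.1 hder).def (half_pos hδ)
  have hsmall' : ∀ᶠ h in 𝓝 (0 : ℝ), ‖g (Real.exp (-h) * a) - g (Real.exp 0 * a)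
      - (-h - 0) • (a * deriv g a)‖ ≤ δ / 2 * ‖-h - 0‖ := by
    have : Tendsto (fun h : ℝ => -h) (𝓝 0) (𝓝 0) := by simpa using tendsto_neg (0 : ℝ)
    exact this.eventually hsmall
  obtain ⟨h, ⟨h1, h2⟩, hpos⟩ := (((hsmall.and hsmall').filter_mono nhdsWithin_le_nhds).and
    (self_mem_nhdsWithin (a := (0 : ℝ)) (s := Set.Ioi 0))).exists
  have hpos : 0 < h := hpos
  simp only [Real.exp_zero, one_mul, sub_zero, smul_eq_mul, Real.norm_eq_abs, abs_neg,
    abs_of_pos hpos] at h1 h2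
  have hlim : ∀ s : ℝ, Tendsto (fun N => gN N (Real.exp s * a) - gN N a) atTop
      (𝓝 (g (Real.exp s * a) - g a)) := fun s =>
    (hQ.tendsto_limit _ (by positivity)).sub (hQ.tendsto_limit a ha0)
  have hδh : 0 < δ * h := mul_pos hδ hpos
  refine ⟨h, hpos, ?_⟩
  filter_upwards [eventually_ge_atTop 1,
    (hlim h).eventually_lt_const (u := (a * deriv g a + δ) * h)
      (by linarith [(abs_le.1 h1).2]),
    (hlim (-h)).eventually_lt_const (u := (a * deriv g a - δ) * (-h))
      (by linarith [(abs_le.1 h2).2])] with N hN hu hl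
  have hmono := monotoneOn_dilation_sub (hQ.differentiableOn N hN)
    (hQ.strictMonoOn N hN).monotoneOn (Real.one_le_exp hpos.le)
  refine ⟨fun r hr hra => (hmono hr ha0 hra.le).trans hu.le, fun r har => le_trans ?_ hl.le⟩
  have hr : 0 < r := ha0.trans_le har
  have h3 := hmono (show Real.exp (-h) * a ∈ Set.Ioi (0 : ℝ) by simp; positivity)
    (show Real.exp (-h) * r ∈ Set.Ioi (0 : ℝ) by simp; positivity)
    (mul_le_mul_of_nonneg_left har (Real.exp_pos _).le)
  simp only [← mul_assoc, ← Real.exp_add, add_neg_cancel, Real.exp_zero, one_mul] at h3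
  linarith

end SuitablePotential

/-! ### Counting indices -/

theorem card_filter_add_one_lt_le (N : ℕ) {x : ℝ} (hx : 0 ≤ x) :
    ((Finset.univ.filter fun k : Fin N => (k : ℝ) + 1 < x).card : ℝ) ≤ x + 1 := by
  have h : (Finset.univ.filter fun k : Fin N => (k : ℝ) + 1 < x).card
      ≤ (Finset.range ⌈x⌉₊).card := by
    refine Finset.card_le_card_of_injOn (fun k => (k : ℕ)) (fun k hk => ?_)
      fun k _ l _ hkl => Fin.ext hkl
    have hk : (k : ℝ) + 1 < x := by simpa using hk
    simp only [Finset.coe_range, Set.mem_Iio]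
    exact Nat.lt_ceil.2 (by linarith)
  rw [Finset.card_range] at h
  calc ((Finset.univ.filter fun k : Fin N => (k : ℝ) + 1 < x).card : ℝ) ≤ (⌈x⌉₊ : ℝ) := by
        exact_mod_cast h
    _ ≤ x + 1 := (Nat.ceil_lt_add_one hx).le

theorem card_filter_lt_add_one_le (N : ℕ) {x : ℝ} (hx : x ≤ N) :
    ((Finset.univ.filter fun k : Fin N => x < (k : ℝ) + 1).card : ℝ) ≤ N - x + 1 := by
  have h : (Finset.univ.filter fun k : Fin N => x < (k : ℝ) + 1).card
      ≤ (Finset.range ⌈(N : ℝ) - x⌉₊).card := by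
    refine Finset.card_le_card_of_injOn (fun k => (k.rev : ℕ)) (fun k hk => ?_)
      fun k _ l _ hkl => Fin.rev_injective (Fin.ext hkl)
    have hk : x < (k : ℝ) + 1 := by simpa using hk
    simp only [Finset.coe_range, Set.mem_Iio]
    refine Nat.lt_ceil.2 ?_
    have : ((k.rev : ℕ) : ℝ) + (k + 1) = N := by
      rw [Fin.val_rev]
      exact_mod_cast Nat.sub_add_cancel k.2
    linarith
  rw [Finset.card_range] at h
  calc ((Finset.univ.filter fun k : Fin N => x < (k : ℝ) + 1).card : ℝ)
      ≤ (⌈(N : ℝ) - x⌉₊ : ℝ) := by exact_mod_cast h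
    _ ≤ N - x + 1 := (Nat.ceil_lt_add_one (by linarith)).le

/-! ### Concentration of the counts -/

theorem tendsto_rpow_mul_one_add_exp_pow {ε κ : ℝ} (hε : 0 < ε) (hκ : 0 < κ) :
    Tendsto (fun N : ℕ => (2 : ℝ) ^ (1 - N * (2 * ε)) * (1 + Real.exp (-(N * κ))) ^ N) atTop
      (𝓝 0) := by
  have hq : (2 : ℝ) ^ (-ε) < 1 := Real.rpow_lt_one_of_one_lt_of_neg one_lt_two (by linarith)
  have hlim : Tendsto (fun N : ℕ => 2 * ((2 : ℝ) ^ (-ε)) ^ N) atTop (𝓝 0) := by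
    simpa using (tendsto_pow_atTop_nhds_zero_of_lt_one (by positivity) hq).const_mul 2
  have hexp : Tendsto (fun N : ℕ => 1 + Real.exp (-(N * κ))) atTop (𝓝 (1 + 0)) :=
    (Real.tendsto_exp_neg_atTop_nhds_zero.comp
      (tendsto_natCast_atTop_atTop.atTop_mul_const hκ)).const_add 1
  have h1 : (1 + 0 : ℝ) < (2 : ℝ) ^ ε := by
    rw [add_zero]
    exact Real.one_lt_rpow one_lt_two hε
  refine squeeze_zero' (Eventually.of_forall fun N => by positivity) ?_ hlim
  filter_upwards [hexp.eventually_lt_const h1] with N hN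
  calc (2 : ℝ) ^ (1 - N * (2 * ε)) * (1 + Real.exp (-(N * κ))) ^ N
      ≤ (2 : ℝ) ^ (1 - N * (2 * ε)) * ((2 : ℝ) ^ ε) ^ N := by gcongr
    _ = 2 * ((2 : ℝ) ^ (-ε)) ^ N := by
      rw [← Real.rpow_natCast, ← Real.rpow_natCast, ← Real.rpow_mul zero_le_two,
        ← Real.rpow_mul zero_le_two, ← Real.rpow_add two_pos]
      nth_rewrite 3 [← Real.rpow_one 2]
      rw [← Real.rpow_add two_pos]
      congr 1
      ring

/-- If, for all but about `N c` indices `k`, a fixed dilation moves the part of the `k`-th radial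
density in `{r | p r}` to where the density is exponentially larger, then asymptotically at most a
fraction `c` of the points has modulus in this set. -/
theorem tendsto_gibbsLaw_count_ge (𝓔 : PlanarEnsemble) {gN : ℕ → ℝ → ℝ}
    (hg : ∀ N, 1 ≤ N → DifferentiableOn ℝ (gN N) (Set.Ioi 0)) (p : ℝ → Prop) [DecidablePred p]
    (hp : MeasurableSet {r | p r}) {c ε κ h : ℝ} (hε : 0 < ε) (hκ : 0 < κ)
    (hB : ∀ᶠ N : ℕ in atTop, ∃ B : Finset (Fin N), (B.card : ℝ) ≤ N * (c + ε) + 1 ∧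
      ∀ k : Fin N, k ∉ B → ∀ r, 0 < r → p r →
        N * (gN N (Real.exp h * r) - gN N r) + N * κ ≤ 𝓔.beta * (k + 1) * h) :
    Tendsto (fun N : ℕ => gibbsLaw 𝓔 (gN N) N
      {z | N * (c + 3 * ε) ≤ (((Finset.univ.filter fun j => p ‖z j‖).card : ℕ) : ℝ)})
      atTop (𝓝 0) := by
  have hlim := ENNReal.tendsto_ofReal (tendsto_rpow_mul_one_add_exp_pow hε hκ)
  rw [ENNReal.ofReal_zero] at hlim
  refine tendsto_of_tendsto_of_tendsto_of_le_of_le' tendsto_const_nhds hlim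
    (Eventually.of_forall fun _ => zero_le) ?_
  filter_upwards [hB, eventually_ge_atTop 1] with N hBN hN
  obtain ⟨B, hcard, hgain⟩ := hBN
  have hm := measurable_radialPotential (hg N hN)
  refine (gibbsLaw_count_ge_le 𝓔 hm p hp B (Real.exp_pos (-(N * κ))).le (fun k hk => ?_) _).trans
    (ENNReal.ofReal_le_ofReal ?_)
  · refine radialMoment_restrict_le hm p _ h κ fun r hr hpr => ?_
    rw [𝓔.two_mul_momentIndex_add_two]
    exact hgain k hk r hr hpr
  · refine mul_le_mul_of_nonneg_right
      (Real.rpow_le_rpow_of_exponent_le one_le_two ?_) (by positivity)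
    linarith

theorem corollary1p4 (𝓔 : PlanarEnsemble) (gN : ℕ → ℝ → ℝ) (g : ℝ → ℝ)
    (hQ : SuitablePotential 𝓔.beta gN g)
    (hZ : ∀ N, 1 ≤ N → partitionFunction 𝓔 (gN N) N < ⊤)
    (a : ℝ) (ha : a ∈ Set.Ioc (0 : ℝ) 1) :
    ∀ ε : ℝ, 0 < ε →
      Tendsto
        (fun N : ℕ => gibbsLaw 𝓔 (gN N) N
          {z | ε ≤ |(countDisc a z : ℝ) / N - a * deriv g a / 𝓔.beta|})
        atTop (𝓝 0) := by
  intro ε hε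
  have hβ := 𝓔.beta_pos
  set T := a * deriv g a with hT
  have hT0 : 0 ≤ T := hQ.mul_deriv_nonneg ha
  have hT1 : T ≤ 𝓔.beta := hQ.mul_deriv_le ha
  -- With `2 δ / β = ε / 3`, the indices with `|β (k + 1) / N - T| < 2 δ` are a small fraction.
  set δ := 𝓔.beta * ε / 6 with hδdef
  have hδ : 0 < δ := by positivity
  obtain ⟨h, hh, hscale⟩ := hQ.exists_scale ha hδ
  have hinside := tendsto_gibbsLaw_count_ge 𝓔 hQ.differentiableOn (fun r => r < a)
    measurableSet_Iio (c := T / 𝓔.beta) (ε := ε / 3) (κ := δ * h) (h := h) (by positivity)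
    (by positivity) (by
      filter_upwards [hscale] with N hN
      refine ⟨Finset.univ.filter fun k : Fin N => (k : ℝ) + 1 < N * (T + 2 * δ) / 𝓔.beta,
        (card_filter_add_one_lt_le N (by positivity)).trans (le_of_eq ?_), ?_⟩
      · rw [hδdef]
        field_simp
        ring
      · intro k hk r hr hra
        have hk : N * (T + 2 * δ) / 𝓔.beta ≤ (k : ℝ) + 1 := by simpa using hk
        rw [div_le_iff₀ hβ] at hk
        have h1 := mul_le_mul_of_nonneg_left (hN.1 r hr hra) (Nat.cast_nonneg (α := ℝ) N)
        have h2 := mul_le_mul_of_nonneg_right hk hh.le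
        linarith)
  have houtside := tendsto_gibbsLaw_count_ge 𝓔 hQ.differentiableOn (fun r => ¬ r < a)
    measurableSet_Iio.compl (c := 1 - T / 𝓔.beta) (ε := ε / 3) (κ := δ * h) (h := -h)
    (by positivity) (by positivity) (by
      filter_upwards [hscale] with N hN
      refine ⟨Finset.univ.filter fun k : Fin N => N * (T - 2 * δ) / 𝓔.beta < (k : ℝ) + 1,
        (card_filter_lt_add_one_le N ?_).trans (le_of_eq ?_), ?_⟩
      · rw [div_le_iff₀ hβ]
        exact mul_le_mul_of_nonneg_left (by linarith) (Nat.cast_nonneg N)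
      · rw [hδdef]
        field_simp
        ring
      · intro k hk r hr hra
        have hk : (k : ℝ) + 1 ≤ N * (T - 2 * δ) / 𝓔.beta := by simpa using hk
        rw [le_div_iff₀ hβ] at hk
        have h1 := mul_le_mul_of_nonneg_left (hN.2 r (not_lt.1 hra)) (Nat.cast_nonneg (α := ℝ) N)
        have h2 := mul_le_mul_of_nonneg_right hk hh.le
        linarith)
  have hsum := hinside.add houtside
  rw [add_zero] at hsum
  refine tendsto_of_tendsto_of_tendsto_of_le_of_le' tendsto_const_nhds hsum
    (Eventually.of_forall fun _ => zero_le) ?_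
  filter_upwards [eventually_ge_atTop 1] with N hN
  refine (measure_mono fun z hz => ?_).trans (measure_union_le _ _)
  have hN' : (0 : ℝ) < N := by exact_mod_cast hN
  have hz : ε ≤ |(countDisc a z : ℝ) / N - T / 𝓔.beta| := hz
  have hcompl : ((countDisc a z : ℕ) : ℝ)
      + (((Finset.univ.filter fun j => ¬ ‖z j‖ < a).card : ℕ) : ℝ) = N := by
    have := Finset.card_filter_add_card_filter_not (s := (Finset.univ : Finset (Fin N)))
      (fun j => ‖z j‖ < a)
    rw [Finset.card_univ, Fintype.card_fin] at this
    exact_mod_cast this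
  rcases le_abs.1 hz with hz | hz
  · left
    change N * (T / 𝓔.beta + 3 * (ε / 3)) ≤ (countDisc a z : ℝ)
    have h1 : T / 𝓔.beta + ε ≤ (countDisc a z : ℝ) / N := by linarith
    rw [le_div_iff₀ hN'] at h1
    linarith
  · right
    change N * (1 - T / 𝓔.beta + 3 * (ε / 3)) ≤ _
    have h1 : (countDisc a z : ℝ) / N ≤ T / 𝓔.beta - ε := by linarith
    rw [div_le_iff₀ hN'] at h1
    linarith
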